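/- Let $Q$ be a smooth finite-dimensional manifold, let $l : TQ \to \mathbb{R}$ be a smooth Lagrangian, and let $\mathscr{L} : TQ \to T^*Q$ be its Legendre transformation (fibre derivative), $\langle \mathscr{L}(v), w\rangle = \frac{d}{dt}\, l(v+tw)\big|_{t=0}$ for $v, w \in T_qQ$. The initial data set $\mathscr{D} \subset TQ$ is the set of all $v \in TQ$ of the form $v = \dot\gamma(0)$, where $\gamma : (-\varepsilon,\varepsilon) \to Q$, for some $\varepsilon > 0$, is a smooth curve that satisfies the Euler-Lagrange equations of $l$; the constraint set is $\mathscr{C} = \mathscr{L}(\mathscr{D}) \subset T^*Q$. Let $\phi : G \times Q \to Q$, $(g,q) \mapsto \phi_g(q)$, be a smooth action of a connected Lie group $G$ on $Q$. Let $\phi'_g = T\phi_g : TQ \to TQ$ be the lifted action on $TQ$, and let $\tilde\phi$ be the lifted action on $T^*Q$, given by $\langle \tilde\phi_g(p), v\rangle = \langle p, \phi'_{g^{-1}}(v)\rangle$ for $p \in T_q^*Q$ and $v \in T_{\phi_g(q)}Q$. **Theorem.** If $G$ is a symmetry group of $l$, that is, if $l \circ \phi'_g = l$ for every $g \in G$,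 then $\phi'$ preserves the initial data set and $\tilde\phi$ preserves the constraint set: for every $g \in G$, $$\phi'_g(\mathscr{D}) = \mathscr{D} \quad\text{and}\quad \tilde\phi_g(\mathscr{C}) = \mathscr{C}.$$ -/

import Mathlib

open Set
open scoped Manifold ContDiff

noncomputable section

namespace LagrangianMechanics

section Manifold

variable {E : Type*} [NormedAddCommGroup E] [NormedSpace ℝ E]
  {Q : Type*} [TopologicalSpace Q] [ChartedSpace E Q]

variable (E Q) in
/-- The cotangent bundle `T*Q` of a manifold `Q` modelled on `E`, as the set of pairs
`(q, p)` with `p` a continuous linear functional on the tangent space `T_q Q`. -/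
abbrev CotangentBundle : Type _ :=
  Bundle.TotalSpace (E →L[ℝ] ℝ) (fun q : Q => TangentSpace 𝓘(ℝ, E) q →L[ℝ] ℝ)

/-- The Legendre transformation `TQ → T*Q` of a Lagrangian `l : TQ → ℝ`, that is its fibre
derivative: `⟨legendre l v, w⟩ = d/dt l(v + t w)` at `t = 0`, for `v` and `w` in the same tangent
space. -/
def legendre (l : TangentBundle 𝓘(ℝ, E) Q → ℝ) (v : TangentBundle 𝓘(ℝ, E) Q) :
    CotangentBundle E Q :=
  ⟨v.proj, fderiv ℝ (fun w : TangentSpace 𝓘(ℝ, E) v.proj => l ⟨v.proj, w⟩) v.2⟩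

variable (E) in
/-- The first jet extension of a curve in `Q`: the curve in `TQ` that associates to each `t` the
tangent vector of the curve `γ` at the point `γ t`. -/
def jet (γ : ℝ → Q) (t : ℝ) : TangentBundle 𝓘(ℝ, E) Q :=
  ⟨γ t, mfderiv 𝓘(ℝ, ℝ) 𝓘(ℝ, E) γ t (1 : ℝ)⟩

/-- The expression of a Lagrangian in the coordinates `(x, u)` on `TQ` (positions and velocities)
that come from a chart `c` of `Q`; meaningful for `x ∈ c.target`. -/
def localLagrangian (l : TangentBundle 𝓘(ℝ, E) Q → ℝ) (c : OpenPartialHomeomorph Q E)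
    (x u : E) : ℝ :=
  l ⟨c.symm x, mfderiv 𝓘(ℝ, E) 𝓘(ℝ, E) c.symm x u⟩

/-- The smooth curve `γ` in `Q`, considered on the open interval `(a, b)` only, satisfies the
Euler-Lagrange equations of `l`: in every smooth chart `c` of `Q`, and at every time `t` at which
the curve lies in the domain of `c`, the curve `x = c ∘ γ` in coordinates satisfies
`d/dt (∂L/∂u (x, dx/dt)) = ∂L/∂x (x, dx/dt)`, where `L` is the Lagrangian in coordinates.
That the left-hand derivative exists is part of `HasDerivAt`. -/
structure IsEulerLagrangeCurve (l : TangentBundle 𝓘(ℝ, E) Q → ℝ) (γ : ℝ → Q) (a b : ℝ) :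
    Prop where
  smooth : ContMDiffOn 𝓘(ℝ, ℝ) 𝓘(ℝ, E) ∞ γ (Ioo a b)
  equations : ∀ c ∈ IsManifold.maximalAtlas 𝓘(ℝ, E) ∞ Q, ∀ t ∈ Ioo a b, γ t ∈ c.source →
    HasDerivAt
      (fun s => fderiv ℝ (fun u => localLagrangian l c (c (γ s)) u) (deriv (fun r => c (γ r)) s))
      (fderiv ℝ (fun x => localLagrangian l c x (deriv (fun r => c (γ r)) t)) (c (γ t))) t

/-- The initial data set: all `v ∈ TQ` that are the value at time `0` of the first jet of a
solution of the Euler-Lagrange equations on some interval `(-ε, ε)`. -/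
def initialDataSet (l : TangentBundle 𝓘(ℝ, E) Q → ℝ) : Set (TangentBundle 𝓘(ℝ, E) Q) :=
  {v | ∃ ε > 0, ∃ γ : ℝ → Q, IsEulerLagrangeCurve l γ (-ε) ε ∧ jet E γ 0 = v}

/-- The constraint set: the image of the initial data set under the Legendre transformation. -/
def constraintSet (l : TangentBundle 𝓘(ℝ, E) Q → ℝ) : Set (CotangentBundle E Q) :=
  legendre l '' initialDataSet l

variable {G : Type*} [Group G] [MulAction G Q]

variable (E) in
/-- The lift to `TQ` of the action of `g` on `Q`, that is the tangent map of `q ↦ g • q`. -/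
def tangentLift (g : G) : TangentBundle 𝓘(ℝ, E) Q → TangentBundle 𝓘(ℝ, E) Q :=
  tangentMap 𝓘(ℝ, E) 𝓘(ℝ, E) (fun q : Q => g • q)

variable (E) in
/-- The lift to `T*Q` of the action of `g` on `Q`: it maps `p ∈ T*_q Q` to the functional
`v ↦ ⟨p, T(g⁻¹) v⟩` on `T_{g • q} Q`. Here `T(g⁻¹) v` lies in the tangent space at
`g⁻¹ • (g • q)`; as this point is `q`, the functional `p` is transported there. -/
def cotangentLift (g : G) (p : CotangentBundle E Q) : CotangentBundle E Q :=
  ⟨g • p.proj,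
    ((inv_smul_smul g p.proj).symm ▸ p.2 :
        TangentSpace 𝓘(ℝ, E) (g⁻¹ • g • p.proj) →L[ℝ] ℝ).comp
      (mfderiv 𝓘(ℝ, E) 𝓘(ℝ, E) (fun q : Q => g⁻¹ • q) (g • p.proj))⟩

variable (G) in
/-- `G` is a symmetry group of `l` if the action lifted to `TQ` leaves `l` invariant. -/
def IsSymmetryGroup (l : TangentBundle 𝓘(ℝ, E) Q → ℝ) : Prop :=
  ∀ g : G, l ∘ tangentLift E g = l

end Manifold

end LagrangianMechanics

end

open Set Filter Topology
open scoped Manifold ContDiff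

namespace LagrangianMechanics

section Invariance

variable {E : Type*} [NormedAddCommGroup E] [NormedSpace ℝ E]
  {Q : Type*} [TopologicalSpace Q] [ChartedSpace E Q]
  {G : Type*} [Group G] [MulAction G Q] {l : TangentBundle 𝓘(ℝ, E) Q → ℝ}

/-! The Euler-Lagrange equations are required in every chart of the maximal atlas, and composing a
chart `c` with the diffeomorphism `q ↦ g • q` gives another such chart. Invariance of `l` makes the
coordinate Lagrangians of the two charts agree, so the equations of `γ` in `c ∘ g` are those of `g •
γ` in `c`: the action permutes solutions, hence their initial jets. Using `g⁻¹` as well turns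
inclusion into equality. The constraint set follows because the Legendre transformation is
equivariant. -/

theorem IsSymmetryGroup.apply_tangentLift (hsymm : IsSymmetryGroup G l) (g : G)
    (v : TangentBundle 𝓘(ℝ, E) Q) : l (tangentLift E g v) = l v :=
  congrFun (hsymm g) v

theorem tangentLift_inv_tangentLift
    (hG : ∀ g : G, ContMDiff 𝓘(ℝ, E) 𝓘(ℝ, E) ∞ (fun q : Q => g • q)) (g : G)
    (v : TangentBundle 𝓘(ℝ, E) Q) : tangentLift E g⁻¹ (tangentLift E g v) = v := by
  have h := tangentMap_comp_at (I := 𝓘(ℝ, E)) (I' := 𝓘(ℝ, E)) (I'' := 𝓘(ℝ, E)) v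
    ((hG g⁻¹).mdifferentiable (by simp) (g • v.proj)) ((hG g).mdifferentiable (by simp) v.proj)
  have hid : (fun q : Q => g⁻¹ • q) ∘ (fun q : Q => g • q) = id := by
    funext q
    simp
  rw [hid, tangentMap_id] at h
  exact h.symm

theorem jet_smul (hG : ∀ g : G, ContMDiff 𝓘(ℝ, E) 𝓘(ℝ, E) ∞ (fun q : Q => g • q)) (g : G)
    {γ : ℝ → Q} {t : ℝ} (hγ : MDifferentiableAt 𝓘(ℝ, ℝ) 𝓘(ℝ, E) γ t) :
    jet E (fun s => g • γ s) t = tangentLift E g (jet E γ t) := by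
  have h := mfderiv_comp t ((hG g).mdifferentiable (by simp) (γ t)) hγ
  have h' := congrArg (fun A : ℝ →L[ℝ] E => A 1) h
  exact congrArg (Bundle.TotalSpace.mk (g • γ t)) h'

/-- The chart `q ↦ c (g • q)`. -/
def smulChart (hG : ∀ g : G, ContMDiff 𝓘(ℝ, E) 𝓘(ℝ, E) ∞ (fun q : Q => g • q)) (g : G)
    (c : OpenPartialHomeomorph Q E) : OpenPartialHomeomorph Q E :=
  Homeomorph.transOpenPartialHomeomorph
    { MulAction.toPerm g with
      continuous_toFun := (hG g).continuous
      continuous_invFun := (hG g⁻¹).continuous } c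

theorem smulChart_mem_maximalAtlas [IsManifold 𝓘(ℝ, E) ∞ Q]
    (hG : ∀ g : G, ContMDiff 𝓘(ℝ, E) 𝓘(ℝ, E) ∞ (fun q : Q => g • q)) (g : G)
    {c : OpenPartialHomeomorph Q E} (hc : c ∈ IsManifold.maximalAtlas 𝓘(ℝ, E) ∞ Q) :
    smulChart hG g c ∈ IsManifold.maximalAtlas 𝓘(ℝ, E) ∞ Q := by
  rw [IsManifold.mem_maximalAtlas_iff_contMDiffOn] at hc ⊢
  exact ⟨hc.1.comp (hG g).contMDiffOn fun q hq => hq, (hG g⁻¹).comp_contMDiffOn hc.2⟩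

/-- The inverse of `c ∘ g` is `g⁻¹ ∘ c.symm`, so by the chain rule the two velocities differ by the
tangent lift of `g⁻¹`, which `l` ignores. -/
theorem IsSymmetryGroup.localLagrangian_smulChart [IsManifold 𝓘(ℝ, E) ∞ Q]
    (hsymm : IsSymmetryGroup G l)
    (hG : ∀ g : G, ContMDiff 𝓘(ℝ, E) 𝓘(ℝ, E) ∞ (fun q : Q => g • q)) (g : G)
    {c : OpenPartialHomeomorph Q E} (hc : c ∈ IsManifold.maximalAtlas 𝓘(ℝ, E) ∞ Q)
    {x : E} (hx : x ∈ c.target) (u : E) :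
    localLagrangian l (smulChart hG g c) x u = localLagrangian l c x u := by
  have hd : MDifferentiableAt 𝓘(ℝ, E) 𝓘(ℝ, E) c.symm x :=
    (contMDiffAt_symm_of_mem_maximalAtlas hc hx).mdifferentiableAt (by simp)
  have h := mfderiv_comp x ((hG g⁻¹).mdifferentiable (by simp) (c.symm x)) hd
  have h' := congrArg (fun A : E →L[ℝ] E => A u) h
  rw [localLagrangian, localLagrangian, ← hsymm.apply_tangentLift g⁻¹ ⟨c.symm x, _⟩]
  exact congrArg (fun w => l (Bundle.TotalSpace.mk (g⁻¹ • c.symm x) w)) h'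

theorem IsEulerLagrangeCurve.smul [IsManifold 𝓘(ℝ, E) ∞ Q] (hsymm : IsSymmetryGroup G l)
    (hG : ∀ g : G, ContMDiff 𝓘(ℝ, E) 𝓘(ℝ, E) ∞ (fun q : Q => g • q)) (g : G)
    {γ : ℝ → Q} {a b : ℝ} (hγ : IsEulerLagrangeCurve l γ a b) :
    IsEulerLagrangeCurve l (fun t => g • γ t) a b where
  smooth := (hG g).comp_contMDiffOn hγ.smooth
  equations c hc t ht hs := by
    have key := hγ.equations _ (smulChart_mem_maximalAtlas hG g hc) t ht hs
    have hcont : ContinuousAt (fun s => g • γ s) t :=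
      (hG g).continuous.continuousAt.comp
        (hγ.smooth.continuousOn.continuousAt (Ioo_mem_nhds ht.1 ht.2))
    have hev : ∀ᶠ s in 𝓝 t, g • γ s ∈ c.source :=
      hcont.eventually (c.open_source.mem_nhds hs)
    -- The Lagrangians agree only over `c.target`; openness makes this enough for the derivative in
    -- `x`.
    have hx : (fun x => localLagrangian l (smulChart hG g c) x (deriv (fun r => c (g • γ r)) t))
        =ᶠ[𝓝 (c (g • γ t))]
          fun x => localLagrangian l c x (deriv (fun r => c (g • γ r)) t) := by
      filter_upwards [c.open_target.mem_nhds (c.map_source hs)] with x hx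
      exact hsymm.localLagrangian_smulChart hG g hc hx _
    rw [← hx.fderiv_eq]
    refine key.congr_of_eventuallyEq ?_
    filter_upwards [hev] with s hs'
    exact congrArg (fun f : E → ℝ => fderiv ℝ f (deriv (fun r => c (g • γ r)) s))
      (funext fun u => (hsymm.localLagrangian_smulChart hG g hc (c.map_source hs') u).symm)

theorem tangentLift_mem_initialDataSet [IsManifold 𝓘(ℝ, E) ∞ Q] (hsymm : IsSymmetryGroup G l)
    (hG : ∀ g : G, ContMDiff 𝓘(ℝ, E) 𝓘(ℝ, E) ∞ (fun q : Q => g • q)) (g : G)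
    {v : TangentBundle 𝓘(ℝ, E) Q} (hv : v ∈ initialDataSet l) :
    tangentLift E g v ∈ initialDataSet l := by
  obtain ⟨ε, hε, γ, hγ, rfl⟩ := hv
  refine ⟨ε, hε, fun t => g • γ t, hγ.smul hsymm hG g, jet_smul hG g ?_⟩
  exact (hγ.smooth.contMDiffAt (Ioo_mem_nhds (by linarith) hε)).mdifferentiableAt (by simp)

theorem image_tangentLift_initialDataSet [IsManifold 𝓘(ℝ, E) ∞ Q] (hsymm : IsSymmetryGroup G l)
    (hG : ∀ g : G, ContMDiff 𝓘(ℝ, E) 𝓘(ℝ, E) ∞ (fun q : Q => g • q)) (g : G) :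
    tangentLift E g '' initialDataSet l = initialDataSet l := by
  refine Subset.antisymm
    (image_subset_iff.2 fun v hv => tangentLift_mem_initialDataSet hsymm hG g hv) fun v hv => ?_
  refine ⟨tangentLift E g⁻¹ v, tangentLift_mem_initialDataSet hsymm hG g⁻¹ hv, ?_⟩
  simpa using tangentLift_inv_tangentLift hG g⁻¹ v

/-- The value of the Legendre transformation at `v`, transported along an equality of the base
points of two equal tangent vectors. -/
theorem transport_legendre_snd {v w : TangentBundle 𝓘(ℝ, E) Q} (hvw : v = w)
    (h : v.proj = w.proj) :
    (h ▸ (legendre l v).2 : TangentSpace 𝓘(ℝ, E) w.proj →L[ℝ] ℝ) = (legendre l w).2 := by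
  subst hvw
  rfl

/-- The Legendre transformation of an invariant Lagrangian is equivariant. -/
theorem IsSymmetryGroup.legendre_tangentLift (hsymm : IsSymmetryGroup G l)
    (hG : ∀ g : G, ContMDiff 𝓘(ℝ, E) 𝓘(ℝ, E) ∞ (fun q : Q => g • q)) (g : G)
    (v : TangentBundle 𝓘(ℝ, E) Q) :
    legendre l (tangentLift E g v) = cotangentLift E g (legendre l v) := by
  have hv := tangentLift_inv_tangentLift hG g v
  let Φ : Q ≃ₘ^∞⟮𝓘(ℝ, E), 𝓘(ℝ, E)⟯ Q :=
    { MulAction.toPerm g⁻¹ with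
      contMDiff_toFun := hG g⁻¹
      contMDiff_invFun := hG g⁻¹⁻¹ }
  let A : E ≃L[ℝ] E := Φ.mfderivToContinuousLinearEquiv (by simp) (g • v.proj)
  let f : E → ℝ := fun w => l ⟨g⁻¹ • g • v.proj, w⟩
  have hf : (fun w : E => l ⟨g • v.proj, w⟩) = f ∘ A :=
    funext fun w => (hsymm.apply_tangentLift g⁻¹ ⟨g • v.proj, w⟩).symm
  -- Since `A`, the tangent map of `g⁻¹`, is invertible, this chain rule needs no differentiability
  -- of `f`.
  have hfib := A.comp_right_fderiv (f := f) (x := (tangentLift E g v).2)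
  rw [← hf] at hfib
  -- The base points `g⁻¹ • g • v.proj` and `v.proj` are not definitionally equal; this matches the
  -- transport in `cotangentLift`.
  have htr := transport_legendre_snd (l := l) hv.symm (inv_smul_smul g v.proj).symm
  refine congrArg (Bundle.TotalSpace.mk (g • v.proj)) (hfib.trans ?_)
  exact congrArg (fun p : E →L[ℝ] ℝ => p.comp (A : E →L[ℝ] E)) htr.symm

theorem image_cotangentLift_constraintSet [IsManifold 𝓘(ℝ, E) ∞ Q] (hsymm : IsSymmetryGroup G l)
    (hG : ∀ g : G, ContMDiff 𝓘(ℝ, E) 𝓘(ℝ, E) ∞ (fun q : Q => g • q)) (g : G) :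
    cotangentLift E g '' constraintSet l = constraintSet l := by
  conv_rhs => rw [constraintSet, ← image_tangentLift_initialDataSet hsymm hG g]
  rw [constraintSet, image_image, image_image]
  exact image_congr fun v _ => (hsymm.legendre_tangentLift hG g v).symm

end Invariance

end LagrangianMechanics

theorem mainTheorem6
    {E : Type*} [NormedAddCommGroup E] [NormedSpace ℝ E] [FiniteDimensional ℝ E]
    {Q : Type*} [TopologicalSpace Q] [ChartedSpace E Q] [IsManifold 𝓘(ℝ, E) ∞ Q]
    {EG : Type*} [NormedAddCommGroup EG] [NormedSpace ℝ EG] [FiniteDimensional ℝ EG]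
    {G : Type*} [TopologicalSpace G] [ChartedSpace EG G] [Group G] [LieGroup 𝓘(ℝ, EG) ∞ G]
    [ConnectedSpace G] [MulAction G Q] [ContMDiffSMul 𝓘(ℝ, EG) 𝓘(ℝ, E) ∞ G Q]
    (l : TangentBundle 𝓘(ℝ, E) Q → ℝ)
    (hl : ContMDiff (𝓘(ℝ, E).tangent) 𝓘(ℝ, ℝ) ∞ l)
    (hsymm : LagrangianMechanics.IsSymmetryGroup G l) :
    (∀ g : G, LagrangianMechanics.tangentLift E g '' LagrangianMechanics.initialDataSet l =
      LagrangianMechanics.initialDataSet l) ∧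
    (∀ g : G, LagrangianMechanics.cotangentLift E g '' LagrangianMechanics.constraintSet l =
      LagrangianMechanics.constraintSet l) := by
  have hG : ∀ g : G, ContMDiff 𝓘(ℝ, E) 𝓘(ℝ, E) ∞ (fun q : Q => g • q) := fun g =>
    ContMDiffSMul.contMDiff_const_smul (I := 𝓘(ℝ, EG)) g
  exact ⟨LagrangianMechanics.image_tangentLift_initialDataSet hsymm hG,
    LagrangianMechanics.image_cotangentLift_constraintSet hsymm hG⟩
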